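/- Let $\lambda,\mu,\alpha>0$. Let $\eta=(\eta(n))_{n\ge 0}$ be a Markov chain on $\mathbb Z^+=\{0,1,2,\dots\}$ with $\eta(0)=0$ and the following transition probabilities: from $0$ it moves to $1$ with probability $1$; from $i\ge 1$ it moves to $i+1$ with probability $\frac{\lambda}{\lambda+\mu}$ and to each $j\in\{0,1,\dots,i-1\}$ with probability $\frac{\mu}{i(\lambda+\mu)}$. Let $\nu=(\nu(t))_{t\ge 0}$ be a Poisson process with rate $\alpha$, independent of $\eta$, on the same probability space $(\Omega,\mathfrak F,\mathbf P)$, and let $\xi(t)=\eta(\nu(t))$, $t\ge 0$ (the Poisson process with uniform catastrophes). Let $\varphi$ be a real-valued function with $\lim_{T\to\infty}\varphi(T)/T=k$ for some $k\in(0,\infty)$, and put $\xi_T(1)=\xi(T)/\varphi(T)$ (defined for all large $T$). Define $J_k:\mathbb R\to[0,\infty]$ by $$ J_k(x)=\begin{cases} \infty, & x<0,\\ x\ln\frac{\lambda+\mu}{\lambda}, & 0\le x<\frac{\alpha}{k},\\ x\ln\frac{kx(\lambda+\mu)}{\alpha\lambda}-x+\frac{\alpha}{k}, & x\ge \frac{\alpha}{k}.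 \end{cases} $$ Then the family $\xi_T(1)$ satisfies, as $T\to\infty$, the large deviation principle on $\mathbb R$ with normalizing function $\psi(T)=\varphi(T)$ and rate function $J_k$. That is: $\varphi(T)\to\infty$ as $T\to\infty$; $J_k$ takes values in $[0,\infty]$; for every $c\ge 0$ the set $\{x\in\mathbb R: J_k(x)\le c\}$ is compact; and for every Borel set $B\subseteq\mathbb R$, with closure $[B]$ and interior $(B)$, $$ \limsup_{T\to\infty}\frac{1}{\varphi(T)}\ln\mathbf P(\xi_T(1)\in B)\le -\inf_{x\in[B]}J_k(x), \qquad \liminf_{T\to\infty}\frac{1}{\varphi(T)}\ln\mathbf P(\xi_T(1)\in B)\ge -\inf_{x\in(B)}J_k(x), $$ where $\ln 0=-\infty$ and $\inf\emptyset=\infty$. -/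

import Mathlib

open MeasureTheory ProbabilityTheory Filter Topology
open scoped NNReal ENNReal

noncomputable section

namespace UniformCatastrophes

/-- Transition probabilities on `ℕ` of the embedded jump chain: from `0` the chain moves to `1` with
probability one; from `i ≠ 0` it moves to `i + 1` with probability `lam / (lam + mu)` and to each of
`0, …, i - 1` with probability `mu / (i * (lam + mu))`. -/
def transProb (lam mu : ℝ) (i j : ℕ) : ℝ :=
  if i = 0 then (if j = 1 then 1 else 0)
  else if j = i + 1 then lam / (lam + mu)
  else if j < i then mu / (i * (lam + mu))
  else 0

/-- `η` is a Markov chain on `ℕ`, started at `0`, with transition probabilities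
`transProb lam mu`. The conditional probability given a finite past is written as a product, so
that pasts of probability zero need no special treatment. -/
structure IsJumpChain {Ω : Type*} [MeasurableSpace Ω] (P : Measure Ω) (lam mu : ℝ)
    (η : ℕ → Ω → ℕ) : Prop where
  measurable : ∀ n, Measurable (η n)
  initial : ∀ᵐ ω ∂P, η 0 ω = 0
  markov : ∀ (n : ℕ) (i : ℕ → ℕ) (j : ℕ),
    P {ω | (∀ m ≤ n, η m ω = i m) ∧ η (n + 1) ω = j} =
      P {ω | ∀ m ≤ n, η m ω = i m} * ENNReal.ofReal (transProb lam mu (i n) j)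

/-- `ν` is a (homogeneous) Poisson process of rate `α`: it starts at `0`, almost all paths are
nondecreasing and right-continuous, increments over disjoint intervals are independent, and the
increment over `[s, t]` has the Poisson law of parameter `α (t - s)`. Since almost all paths are
nondecreasing, the natural-number subtraction in the increments is the true one almost surely. -/
structure IsPoissonProcess {Ω : Type*} [MeasurableSpace Ω] (P : Measure Ω) (α : ℝ≥0)
    (ν : ℝ≥0 → Ω → ℕ) : Prop where
  measurable : ∀ t, Measurable (ν t)
  initial : ∀ᵐ ω ∂P, ν 0 ω = 0
  monotone : ∀ᵐ ω ∂P, Monotone fun t => ν t ω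
  rightCont : ∀ᵐ ω ∂P, ∀ t, ContinuousWithinAt (fun s => ν s ω) (Set.Ioi t) t
  indepIncrements : HasIndepIncrements ν P
  law : ∀ s t : ℝ≥0, s ≤ t → HasLaw (fun ω => ν t ω - ν s ω) (poissonMeasure (α * (t - s))) P

/-- The process `ξ(t) = η(ν(t))`. -/
def process {Ω : Type*} (η : ℕ → Ω → ℕ) (ν : ℝ≥0 → Ω → ℕ) (t : ℝ≥0) (ω : Ω) : ℕ :=
  η (ν t ω) ω

/-- `ξ` is a Poisson process with uniform catastrophes, with parameters `lam`, `mu`, `α`: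
`ξ(t) = η(ν(t))` where the jump chain `η` and the Poisson process `ν` are independent
(as whole processes). -/
def IsPoissonUniformCatastrophes {Ω : Type*} [MeasurableSpace Ω] (P : Measure Ω)
    (lam mu : ℝ) (α : ℝ≥0) (ξ : ℝ≥0 → Ω → ℕ) : Prop :=
  ∃ (η : ℕ → Ω → ℕ) (ν : ℝ≥0 → Ω → ℕ),
    IsJumpChain P lam mu η ∧ IsPoissonProcess P α ν ∧
    IndepFun (fun ω t => ν t ω) (fun ω n => η n ω) P ∧
    ξ = process η ν

/-- The scaled process `ξ_T(t) = ξ(T t) / φ(T)`. -/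
def scaled {Ω : Type*} (ξ : ℝ≥0 → Ω → ℕ) (φ : ℝ≥0 → ℝ) (T t : ℝ≥0) (ω : Ω) : ℝ :=
  (ξ (T * t) ω : ℝ) / φ T

/-- The large deviation principle on `ℝ`, as `T → ∞`, for a family `X T` of real random variables,
with rate function `I : ℝ → [0, ∞]` (with compact level sets) and normalizing function `ψ → ∞`.
Logarithms, upper and lower limits and infima are taken in the extended reals, with `log 0 = -∞` and
`inf ∅ = +∞`. -/
structure SatisfiesLDP {Ω : Type*} [MeasurableSpace Ω] (P : Measure Ω)
    (X : ℝ≥0 → Ω → ℝ) (ψ : ℝ≥0 → ℝ) (I : ℝ → EReal) : Prop where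
  tendsto_normalization : Tendsto ψ atTop atTop
  nonneg : ∀ x, 0 ≤ I x
  isCompact_level : ∀ c : ℝ, 0 ≤ c → IsCompact {x : ℝ | I x ≤ (c : EReal)}
  upper : ∀ B : Set ℝ, MeasurableSet B →
    limsup (fun T : ℝ≥0 => ((1 / ψ T : ℝ) : EReal) * ENNReal.log (P {ω | X T ω ∈ B})) atTop
      ≤ -(⨅ x ∈ closure B, I x)
  lower : ∀ B : Set ℝ, MeasurableSet B →
    -(⨅ x ∈ interior B, I x)
      ≤ liminf (fun T : ℝ≥0 => ((1 / ψ T : ℝ) : EReal) * ENNReal.log (P {ω | X T ω ∈ B})) atTop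

/-- The rate function `J_k` of the linear regime. -/
def rateJ (lam mu α k : ℝ) (x : ℝ) : EReal :=
  if x < 0 then ⊤
  else if x < α / k then ((x * Real.log ((lam + mu) / lam) : ℝ) : EReal)
  else ((x * Real.log (k * x * (lam + mu) / (α * lam)) - x + α / k : ℝ) : EReal)

end UniformCatastrophes

end

/-! Write `p = lam / (lam + mu)`. Height `m` costs the jump chain about `p ^ m`, however many steps
`n ≥ m` it has made. From above: a catastrophe hits a given state `j` with probability at most of
order `1 / j`, so for every `r > p` the sequence `r ^ j` is a supersolution of the forward equation
at large `j`, which gives a bound `C * r ^ m` uniform in time (`IsJumpChain.exists_measure_eq_le`).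
From below: the law is tight, and running straight up during the last `m` steps costs `p ^ m`
(`IsJumpChain.exists_le_measure_mem_Icc`).

The chain gains at most one unit per step, so reaching `x * φ T` also needs that many Poisson events
by time `T`. At rate `y = max (k * x) α` this has the Poisson cost `y log (y / α) - y + α` per unit
time, which is zero when `k * x ≤ α`. The two costs add up to `J_k`. The upper bound is a Chernoff
estimate for half-lines; the lower bound keeps a single value of the Poisson variable and uses
Stirling. -/

namespace UniformCatastrophes

/-! ### Uniform-in-time tail bounds for the embedded jump chain. -/

section JumpChain

variable {Ω : Type*} [MeasurableSpace Ω] {P : Measure Ω}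

/-- A measure disintegrates over the fibres of a measurable map into a countable type. -/
lemma measure_eq_tsum_inter_fiber {β : Type*} [MeasurableSpace β] [MeasurableSingletonClass β]
    [Countable β] {X : Ω → β} (hX : Measurable X) (A : Set Ω) :
    P A = ∑' b, P (A ∩ X ⁻¹' {b}) := by
  have h := tsum_measure_preimage_singleton (μ := P.restrict A) (s := Set.univ)
    Set.countable_univ (f := X) (fun y _ => hX (measurableSet_singleton y))
  rw [tsum_univ (fun b => P.restrict A (X ⁻¹' {b}))] at h
  simp only [Set.preimage_univ, Measure.restrict_apply_univ] at h
  rw [← h]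
  refine tsum_congr fun b => ?_
  rw [Measure.restrict_apply (hX (measurableSet_singleton b)), Set.inter_comm]

variable {lam mu : ℝ} {η : ℕ → Ω → ℕ}

/-- The Markov property is given only for complete histories, so both sides are summed over the
histories `f` up to time `n`; those not ending at `i` contribute zero. -/
lemma IsJumpChain.measure_inter_next (h : IsJumpChain P lam mu η) (n i j : ℕ) :
    P {ω | η n ω = i ∧ η (n + 1) ω = j} =
      P {ω | η n ω = i} * ENNReal.ofReal (transProb lam mu i j) := by
  have hX : Measurable fun ω (m : Fin (n + 1)) => η m ω :=
    measurable_pi_lambda _ fun m => h.measurable m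
  rw [measure_eq_tsum_inter_fiber hX {ω | η n ω = i ∧ η (n + 1) ω = j},
    measure_eq_tsum_inter_fiber hX {ω | η n ω = i}, ← ENNReal.tsum_mul_right]
  refine tsum_congr fun f => ?_
  have hfib : ∀ ω, (fun m : Fin (n + 1) => η m ω) = f ↔
      ∀ m ≤ n, η m ω = if hm : m < n + 1 then f ⟨m, hm⟩ else 0 := by
    intro ω
    rw [funext_iff]
    constructor
    · intro H m hm
      rw [dif_pos (Nat.lt_succ_of_le hm)]
      exact H ⟨m, Nat.lt_succ_of_le hm⟩
    · intro H m
      rw [H m (Nat.le_of_lt_succ m.2), dif_pos m.2]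
  by_cases hf : f (Fin.last n) = i
  · have hm := h.markov n (fun m => if hm : m < n + 1 then f ⟨m, hm⟩ else 0) j
    have hlast : (if hm : n < n + 1 then f ⟨n, hm⟩ else 0) = i := by
      rw [dif_pos (Nat.lt_succ_self n)]; exact hf
    simp only [hlast] at hm
    have hn : ∀ ω, (fun m : Fin (n + 1) => η m ω) = f → η n ω = i := by
      intro ω hω
      rw [← hf, ← hω]; rfl
    convert hm using 3
    · ext ω
      simp only [Set.mem_inter_iff, Set.mem_ofPred_eq, Set.mem_preimage, Set.mem_singleton_iff,
        ← hfib]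
      exact ⟨fun H => ⟨H.2, H.1.2⟩, fun H => ⟨⟨hn ω H.1, H.2⟩, H.1⟩⟩
    · ext ω
      simp only [Set.mem_inter_iff, Set.mem_ofPred_eq, Set.mem_preimage, Set.mem_singleton_iff,
        ← hfib]
      exact ⟨fun H => H.2, fun H => ⟨hn ω H, H⟩⟩
  · have hn : ∀ ω, (fun m : Fin (n + 1) => η m ω) = f → η n ω ≠ i := by
      intro ω hω h'
      exact hf (by rw [← h', ← hω]; rfl)
    have h1 : {ω | η n ω = i ∧ η (n + 1) ω = j} ∩ (fun ω (m : Fin (n + 1)) => η m ω) ⁻¹' {f} = ∅ :=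
      Set.eq_empty_of_forall_notMem fun ω H => hn ω H.2 H.1.1
    have h2 : {ω | η n ω = i} ∩ (fun ω (m : Fin (n + 1)) => η m ω) ⁻¹' {f} = ∅ :=
      Set.eq_empty_of_forall_notMem fun ω H => hn ω H.2 H.1
    rw [h1, h2]; simp

/-- The forward equation for the one-dimensional laws of the jump chain. -/
lemma IsJumpChain.measure_next (h : IsJumpChain P lam mu η) (n j : ℕ) :
    P {ω | η (n + 1) ω = j} =
      ∑' i, P {ω | η n ω = i} * ENNReal.ofReal (transProb lam mu i j) := by
  rw [measure_eq_tsum_inter_fiber (h.measurable n) {ω | η (n + 1) ω = j}]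
  refine tsum_congr fun i => ?_
  rw [← h.measure_inter_next]
  congr 1
  ext ω
  exact and_comm

lemma IsJumpChain.measure_eq_zero_of_lt (h : IsJumpChain P lam mu η) {n m : ℕ} (hnm : n < m) :
    P {ω | η n ω = m} = 0 := by
  induction n generalizing m with
  | zero =>
    refine measure_mono_null (fun ω hω => ?_) h.initial
    have : η 0 ω = m := hω
    simp only [Set.mem_compl_iff, Set.mem_ofPred_eq]
    omega
  | succ n ih =>
    rw [h.measure_next, ENNReal.tsum_eq_zero]
    intro i
    rcases lt_or_ge n i with hi | hi
    · rw [ih hi, zero_mul]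
    · have : transProb lam mu i m = 0 := by
        unfold transProb
        split_ifs <;> first | omega | rfl
      rw [this]; simp

lemma lam_div_le_transProb_succ (hlam : 0 < lam) (hmu : 0 < mu) (i : ℕ) :
    lam / (lam + mu) ≤ transProb lam mu i (i + 1) := by
  unfold transProb
  split_ifs with h1 h2 h3 <;> first | omega | exact le_rfl | skip
  rw [div_le_one (by positivity)]; linarith

/-- Running straight up for `m` steps costs at most a factor `(lam / (lam + mu)) ^ m`. -/
lemma IsJumpChain.pow_mul_le_measure_add (h : IsJumpChain P lam mu η) (hlam : 0 < lam)
    (hmu : 0 < mu) (n m i : ℕ) :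
    ENNReal.ofReal (lam / (lam + mu)) ^ m * P {ω | η n ω = i} ≤ P {ω | η (n + m) ω = i + m} := by
  induction m with
  | zero => simp
  | succ m ih =>
    calc ENNReal.ofReal (lam / (lam + mu)) ^ (m + 1) * P {ω | η n ω = i}
        = (ENNReal.ofReal (lam / (lam + mu)) ^ m * P {ω | η n ω = i}) *
            ENNReal.ofReal (lam / (lam + mu)) := by ring
      _ ≤ P {ω | η (n + m) ω = i + m} *
            ENNReal.ofReal (transProb lam mu (i + m) (i + m + 1)) := by
          gcongr
          exact lam_div_le_transProb_succ hlam hmu _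
      _ = P {ω | η (n + m) ω = i + m ∧ η (n + m + 1) ω = i + m + 1} :=
          (h.measure_inter_next _ _ _).symm
      _ ≤ P {ω | η (n + (m + 1)) ω = i + (m + 1)} := measure_mono fun ω hω => hω.2

lemma hasSum_mul_geometric_add {r : ℝ} (hr0 : 0 ≤ r) (hr1 : r < 1) (c : ℝ) (m : ℕ) :
    HasSum (fun i => c * r ^ (i + m)) (c * (r ^ m / (1 - r))) := by
  have h := (hasSum_geometric_of_lt_one hr0 hr1).mul_left (c * r ^ m)
  rw [mul_assoc, ← div_eq_mul_inv] at h
  simpa only [pow_add, mul_assoc, mul_comm (r ^ m)] using h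

/-- Supersolution estimate for the weights `r ^ i`: state `j - 1` sends `r ^ (j - 1) * lam / (lam +
mu)` into `j`, and catastrophes from above send at most `mu / (j * (lam + mu))` times the tail `r ^
(j + 1) / (1 - r)`. -/
lemma tsum_transProb_geometric_le (hlam : 0 < lam) (hmu : 0 < mu) {r : ℝ} (hr0 : 0 < r)
    (hr1 : r < 1) {j : ℕ} (hj2 : 2 ≤ j)
    (hj : lam / (lam + mu) + mu / (j * (lam + mu)) * (r ^ 2 / (1 - r)) ≤ r) :
    ∑' i, ENNReal.ofReal (r ^ i) * ENNReal.ofReal (transProb lam mu i j) ≤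
      ENNReal.ofReal (r ^ j) := by
  obtain ⟨l, rfl⟩ : ∃ l, j = l + 1 := ⟨j - 1, by omega⟩
  set c := mu / ((l + 1 : ℕ) * (lam + mu)) with hc
  have hc0 : 0 ≤ c := by positivity
  have hr1' : 0 < 1 - r := by linarith
  have hterm : ∀ i, ENNReal.ofReal (r ^ i) * ENNReal.ofReal (transProb lam mu i (l + 1)) ≤
      (if i = l then ENNReal.ofReal (r ^ l * (lam / (lam + mu))) else 0) +
        if l + 2 ≤ i then ENNReal.ofReal (c * r ^ i) else 0 := by
    intro i
    rw [← ENNReal.ofReal_mul (by positivity)]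
    unfold transProb
    -- The exceptional state `0` feeds only state `1`, hence not `l + 1 ≥ 2`.
    by_cases h0 : i = 0
    · rw [if_pos h0, if_neg (by omega)]; simp
    rw [if_neg h0]
    by_cases h1 : i = l
    · rw [if_pos (by omega), if_pos h1, h1]; exact le_self_add
    rw [if_neg (by omega), if_neg h1, zero_add]
    by_cases h2 : l + 1 < i
    · rw [if_pos h2, if_pos (by omega)]
      apply ENNReal.ofReal_le_ofReal
      rw [mul_comm, hc]
      gcongr
    · rw [if_neg h2]; simp
  refine (ENNReal.tsum_le_tsum hterm).trans ?_
  rw [ENNReal.tsum_add, tsum_ite_eq]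
  have htail : (∑' i, if l + 2 ≤ i then ENNReal.ofReal (c * r ^ i) else 0) =
      ENNReal.ofReal (c * (r ^ (l + 2) / (1 - r))) := by
    rw [← (ENNReal.summable).sum_add_tsum_nat_add' (k := l + 2)]
    rw [Finset.sum_eq_zero, zero_add]
    · have hs := hasSum_mul_geometric_add hr0.le hr1 c (l + 2)
      rw [← hs.tsum_eq, ENNReal.ofReal_tsum_of_nonneg (fun i => by positivity) hs.summable]
      exact tsum_congr fun i => by rw [if_pos (by omega)]
    · intro i hi
      rw [Finset.mem_range] at hi
      rw [if_neg (by omega)]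
  rw [htail, ← ENNReal.ofReal_add (by positivity) (by positivity)]
  apply ENNReal.ofReal_le_ofReal
  calc r ^ l * (lam / (lam + mu)) + c * (r ^ (l + 2) / (1 - r))
      = r ^ l * (lam / (lam + mu) + c * (r ^ 2 / (1 - r))) := by ring
    _ ≤ r ^ l * r := by gcongr
    _ = r ^ (l + 1) := by ring

/-- The one-dimensional laws of the jump chain decay geometrically, uniformly in time, at every
rate above `lam / (lam + mu)`. -/
lemma IsJumpChain.exists_measure_eq_le [IsProbabilityMeasure P] (h : IsJumpChain P lam mu η)
    (hlam : 0 < lam) (hmu : 0 < mu) {r : ℝ} (hr : lam / (lam + mu) < r) (hr1 : r < 1) :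
    ∃ C : ℝ, 0 < C ∧ ∀ n m, P {ω | η n ω = m} ≤ ENNReal.ofReal (C * r ^ m) := by
  have hr0 : 0 < r := lt_trans (by positivity) hr
  have hr1' : 0 < 1 - r := by linarith
  -- Beyond `M` the catastrophe inflow, of order `1 / j`, fits into the gap `r - lam / (lam + mu)`.
  obtain ⟨M, hM⟩ := exists_nat_gt (mu / (lam + mu) * (r ^ 2 / (1 - r)) / (r - lam / (lam + mu)))
  have hrec : ∀ j : ℕ, M + 2 ≤ j →
      lam / (lam + mu) + mu / (j * (lam + mu)) * (r ^ 2 / (1 - r)) ≤ r := by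
    intro j hj
    have hjM : (M : ℝ) ≤ j := by exact_mod_cast (by omega : M ≤ j)
    have hj0 : (0 : ℝ) < j := by exact_mod_cast (by omega : 0 < j)
    rw [div_lt_iff₀ (by linarith)] at hM
    have h1 : mu / (lam + mu) * (r ^ 2 / (1 - r)) ≤ j * (r - lam / (lam + mu)) :=
      hM.le.trans (by gcongr)
    have h2 : mu / (j * (lam + mu)) * (r ^ 2 / (1 - r)) =
        mu / (lam + mu) * (r ^ 2 / (1 - r)) / j := by field_simp
    rw [h2]
    have := (div_le_iff₀' hj0).2 h1
    linarith
  -- With this constant the bound is at least `1` for `m ≤ M + 2`, so only the supersolution range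
  -- needs the induction on time.
  refine ⟨(r ^ (M + 2))⁻¹, by positivity, fun n => ?_⟩
  have hsmall : ∀ n m, m ≤ M + 2 →
      P {ω | η n ω = m} ≤ ENNReal.ofReal ((r ^ (M + 2))⁻¹ * r ^ m) := by
    intro n m hm
    refine prob_le_one.trans ?_
    rw [ENNReal.one_le_ofReal, inv_mul_eq_div, one_le_div (by positivity)]
    exact pow_le_pow_of_le_one hr0.le hr1.le hm
  induction n with
  | zero =>
    intro m
    rcases Nat.eq_zero_or_pos m with rfl | hm
    · exact hsmall 0 0 (by omega)
    · rw [h.measure_eq_zero_of_lt hm]; exact zero_le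
  | succ n ih =>
    intro m
    rcases le_total m (M + 2) with hm | hm
    · exact hsmall _ _ hm
    · rw [h.measure_next]
      calc ∑' i, P {ω | η n ω = i} * ENNReal.ofReal (transProb lam mu i m)
          ≤ ∑' i, ENNReal.ofReal (r ^ (M + 2))⁻¹ *
              (ENNReal.ofReal (r ^ i) * ENNReal.ofReal (transProb lam mu i m)) := by
            refine ENNReal.tsum_le_tsum fun i => ?_
            rw [← mul_assoc, ← ENNReal.ofReal_mul (by positivity)]
            gcongr
            exact ih i
        _ ≤ ENNReal.ofReal (r ^ (M + 2))⁻¹ * ENNReal.ofReal (r ^ m) := by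
            rw [ENNReal.tsum_mul_left]
            gcongr
            exact tsum_transProb_geometric_le hlam hmu hr0 hr1 (by omega) (hrec m hm)
        _ = _ := by rw [← ENNReal.ofReal_mul (by positivity)]

lemma IsJumpChain.exists_measure_ge_le [IsProbabilityMeasure P] (h : IsJumpChain P lam mu η)
    (hlam : 0 < lam) (hmu : 0 < mu) {r : ℝ} (hr : lam / (lam + mu) < r) (hr1 : r < 1) :
    ∃ C : ℝ, 0 < C ∧ ∀ n m, P {ω | m ≤ η n ω} ≤ ENNReal.ofReal (C * r ^ m) := by
  have hr0 : 0 < r := lt_trans (by positivity) hr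
  have hr1' : 0 < 1 - r := by linarith
  obtain ⟨C, hC, hb⟩ := h.exists_measure_eq_le hlam hmu hr hr1
  refine ⟨C / (1 - r), by positivity, fun n m => ?_⟩
  have hs := hasSum_mul_geometric_add hr0.le hr1 C m
  rw [div_mul_eq_mul_div, mul_div_assoc, ← hs.tsum_eq,
    ENNReal.ofReal_tsum_of_nonneg (fun i => by positivity) hs.summable]
  calc P {ω | m ≤ η n ω} ≤ P (⋃ i, {ω | η n ω = i + m}) := by
        refine measure_mono fun ω (hω : m ≤ η n ω) => ?_
        exact Set.mem_iUnion.2 ⟨η n ω - m, by simp only [Set.mem_ofPred_eq]; omega⟩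
    _ ≤ ∑' i, P {ω | η n ω = i + m} := measure_iUnion_le _
    _ ≤ _ := ENNReal.tsum_le_tsum fun i => hb n (i + m)

lemma IsJumpChain.measure_ge_eq_zero_of_lt (h : IsJumpChain P lam mu η) {n m : ℕ} (hnm : n < m) :
    P {ω | m ≤ η n ω} = 0 := by
  refine measure_mono_null (t := ⋃ i, {ω | η n ω = i + m}) (fun ω (hω : m ≤ η n ω) => ?_) ?_
  · exact Set.mem_iUnion.2 ⟨η n ω - m, by simp only [Set.mem_ofPred_eq]; omega⟩
  · exact measure_iUnion_null fun i => h.measure_eq_zero_of_lt (by omega)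

/-- The jump chain is tight, so it reaches height about `m` with probability at least a constant
times `(lam / (lam + mu)) ^ m` at every time from `m` on. -/
lemma IsJumpChain.exists_le_measure_mem_Icc [IsProbabilityMeasure P] (h : IsJumpChain P lam mu η)
    (hlam : 0 < lam) (hmu : 0 < mu) :
    ∃ M : ℕ, ∀ n m, m ≤ n →
      ENNReal.ofReal ((lam / (lam + mu)) ^ m / 2) ≤ P {ω | m ≤ η n ω ∧ η n ω ≤ m + M} := by
  obtain ⟨r, hr, hr1⟩ := exists_between (show lam / (lam + mu) < 1 by
    rw [div_lt_one (by positivity)]; linarith)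
  have hr0 : 0 < r := lt_trans (by positivity) hr
  obtain ⟨C, hC, hb⟩ := h.exists_measure_ge_le hlam hmu hr hr1
  -- This makes the tail above `M` at most `1 / 2` at all times.
  obtain ⟨M, hM⟩ := exists_pow_lt_of_lt_one (show 0 < 1 / (2 * C) by positivity) hr1
  have hlow : ∀ n, ENNReal.ofReal (1 / 2) ≤ P {ω | η n ω ≤ M} := by
    intro n
    have h1 : P {ω | η n ω ≤ M}ᶜ ≤ ENNReal.ofReal (1 / 2) := by
      calc P {ω | η n ω ≤ M}ᶜ ≤ P {ω | M ≤ η n ω} := by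
            refine measure_mono fun ω hω => ?_
            simp only [Set.mem_compl_iff, Set.mem_ofPred_eq, not_le] at hω ⊢
            exact hω.le
        _ ≤ _ := hb n M
        _ ≤ _ := by
            apply ENNReal.ofReal_le_ofReal
            have := (lt_div_iff₀ (by positivity)).1 hM
            linarith
    have hms : MeasurableSet {ω | η n ω ≤ M} := h.measurable n measurableSet_Iic
    have h2 := prob_add_prob_compl (μ := P) hms
    have h3 : ENNReal.ofReal (1 / 2) + ENNReal.ofReal (1 / 2) = 1 := by
      rw [← ENNReal.ofReal_add (by norm_num) (by norm_num)]; norm_num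
    by_contra hlt
    rw [not_le] at hlt
    have : P {ω | η n ω ≤ M} + P {ω | η n ω ≤ M}ᶜ < 1 := by
      rw [← h3]; exact ENNReal.add_lt_add_of_lt_of_le (ne_top_of_le_ne_top (by simp) h1) hlt h1
    exact this.ne h2
  refine ⟨M, fun n m hmn => ?_⟩
  -- At time `l = n - m` the chain is below `M` with probability at least `1 / 2`; the remaining `m`
  -- steps go straight up.
  obtain ⟨l, rfl⟩ := Nat.exists_eq_add_of_le' hmn
  have hsum : ∀ (n a : ℕ), P {ω | a ≤ η n ω ∧ η n ω ≤ a + M} =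
      ∑ i ∈ Finset.range (M + 1), P {ω | η n ω = i + a} := by
    intro n a
    rw [← measure_biUnion_finset]
    · congr 1
      ext ω
      simp only [Set.mem_ofPred_eq, Set.mem_iUnion, Finset.mem_range, exists_prop]
      exact ⟨fun H => ⟨η n ω - a, by omega, by omega⟩, fun ⟨i, h1, h2⟩ => by omega⟩
    · intro i _ j _ hij
      refine Set.disjoint_left.2 fun ω (h1 : η n ω = _) (h2 : η n ω = _) => hij (by omega)
    · exact fun i _ => h.measurable n (measurableSet_singleton _)
  have h0 : P {ω | η l ω ≤ M} = ∑ i ∈ Finset.range (M + 1), P {ω | η l ω = i} := by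
    have := hsum l 0
    simpa using this
  calc ENNReal.ofReal ((lam / (lam + mu)) ^ m / 2)
      = ENNReal.ofReal (lam / (lam + mu)) ^ m * ENNReal.ofReal (1 / 2) := by
        rw [← ENNReal.ofReal_pow (by positivity), ← ENNReal.ofReal_mul (by positivity)]
        congr 1; ring
    _ ≤ ENNReal.ofReal (lam / (lam + mu)) ^ m * P {ω | η l ω ≤ M} := by gcongr; exact hlow l
    _ ≤ P {ω | m ≤ η (l + m) ω ∧ η (l + m) ω ≤ m + M} := by
        rw [hsum, h0, Finset.mul_sum]
        exact Finset.sum_le_sum fun i _ => h.pow_mul_le_measure_add hlam hmu l m i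

end JumpChain

/-! ### Mixing the chain estimates over the Poisson number of steps. -/

section Mixture

variable {Ω : Type*} [MeasurableSpace Ω] {P : Measure Ω} {lam mu : ℝ} {α : ℝ≥0}
  {η : ℕ → Ω → ℕ} {ν : ℝ≥0 → Ω → ℕ}

lemma IsPoissonProcess.measure_eq (h : IsPoissonProcess P α ν) (T : ℝ≥0) (n : ℕ) :
    P {ω | ν T ω = n} = ENNReal.ofReal (Real.exp (-(α * T)) * (α * T) ^ n / n.factorial) := by
  have h1 := (h.law 0 T zero_le).measure_eq (p := fun x => x = n) (measurableSet_singleton n)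
  have h2 : P {ω | ν T ω = n} = P {ω | ν T ω - ν 0 ω = n} := by
    refine measure_congr ?_
    filter_upwards [h.initial] with ω hω
    change (ν T ω = n) = (ν T ω - ν 0 ω = n)
    rw [hω, Nat.sub_zero]
  have h3 := poissonMeasure_singleton (α * (T - 0)) n
  rw [h2, h1]
  refine h3.trans ?_
  simp

lemma measure_inter_process_mem (hind : IndepFun (fun ω t => ν t ω) (fun ω n => η n ω) P)
    (T : ℝ≥0) (n : ℕ) (S : Set ℕ) :
    P ({ω | process η ν T ω ∈ S} ∩ ν T ⁻¹' {n}) = P {ω | ν T ω = n} * P {ω | η n ω ∈ S} := by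
  have h1 : IndepFun (ν T) (η n) P :=
    hind.comp (measurable_pi_apply T) (measurable_pi_apply n)
  have h2 := h1.measure_inter_preimage_eq_mul {n} S (measurableSet_singleton n)
    (Set.to_countable S).measurableSet
  refine Eq.trans ?_ h2
  congr 1
  ext ω
  simp only [process, Set.mem_inter_iff, Set.mem_ofPred_eq, Set.mem_preimage,
    Set.mem_singleton_iff]
  constructor
  · rintro ⟨h, rfl⟩; exact ⟨rfl, h⟩
  · rintro ⟨rfl, h⟩; exact ⟨h, rfl⟩

/-- Chernoff bound for the upper tail of the process. -/
lemma exists_measure_process_ge_le [IsProbabilityMeasure P] (hη : IsJumpChain P lam mu η)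
    (hν : IsPoissonProcess P α ν) (hind : IndepFun (fun ω t => ν t ω) (fun ω n => η n ω) P)
    (hlam : 0 < lam) (hmu : 0 < mu) {r : ℝ} (hr : lam / (lam + mu) < r) (hr1 : r < 1) :
    ∃ C : ℝ, 0 < C ∧ ∀ (T : ℝ≥0) (θ : ℝ) (m : ℕ), 0 ≤ θ → P {ω | m ≤ process η ν T ω} ≤
      ENNReal.ofReal (C * r ^ m * Real.exp (-θ * m + α * T * (Real.exp θ - 1))) := by
  have hr0 : 0 < r := lt_trans (by positivity) hr
  obtain ⟨C, hC, hb⟩ := hη.exists_measure_ge_le hlam hmu hr hr1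
  refine ⟨C, hC, fun T θ m hθ => ?_⟩
  set a : ℝ := α * T with ha
  have ha0 : 0 ≤ a := by positivity
  have hs : HasSum (fun n : ℕ => C * r ^ m * Real.exp (-θ * m - a) *
      ((a * Real.exp θ) ^ n / n.factorial))
      (C * r ^ m * Real.exp (-θ * m + a * (Real.exp θ - 1))) := by
    have h1 := (NormedSpace.expSeries_div_hasSum_exp (a * Real.exp θ)).mul_left
      (C * r ^ m * Real.exp (-θ * m - a))
    rw [← Real.exp_eq_exp_ℝ, mul_assoc (C * r ^ m) _ (Real.exp (a * Real.exp θ)),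
      ← Real.exp_add,
      show -θ * m - a + a * Real.exp θ = -θ * m + a * (Real.exp θ - 1) by ring] at h1
    exact h1
  rw [measure_eq_tsum_inter_fiber (hν.measurable T), ← hs.tsum_eq,
    ENNReal.ofReal_tsum_of_nonneg (fun n => by positivity) hs.summable]
  refine ENNReal.tsum_le_tsum fun n => ?_
  rw [show {ω | m ≤ process η ν T ω} = {ω | process η ν T ω ∈ Set.Ici m} from rfl,
    measure_inter_process_mem hind]
  change _ * P {ω | m ≤ η n ω} ≤ _
  rcases lt_or_ge n m with hnm | hnm
  · rw [hη.measure_ge_eq_zero_of_lt hnm, mul_zero]; exact zero_le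
  calc P {ω | ν T ω = n} * P {ω | m ≤ η n ω}
      ≤ ENNReal.ofReal (Real.exp (-a) * a ^ n / n.factorial) * ENNReal.ofReal (C * r ^ m) := by
        rw [hν.measure_eq]; gcongr; exact hb n m
    _ ≤ _ := by
        rw [← ENNReal.ofReal_mul (by positivity)]
        apply ENNReal.ofReal_le_ofReal
        -- The exponential tilt: `exp (θ * (n - m)) ≥ 1`, because only `n ≥ m` contributes.
        have h2 : 1 ≤ Real.exp (-θ * m) * Real.exp θ ^ n := by
          rw [← Real.exp_nat_mul, ← Real.exp_add]
          apply Real.one_le_exp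
          have : (m : ℝ) ≤ n := by exact_mod_cast hnm
          nlinarith
        calc Real.exp (-a) * a ^ n / n.factorial * (C * r ^ m)
            ≤ Real.exp (-a) * a ^ n / n.factorial * (C * r ^ m) *
              (Real.exp (-θ * m) * Real.exp θ ^ n) := le_mul_of_one_le_right (by positivity) h2
          _ = _ := by
            rw [sub_eq_add_neg, Real.exp_add, mul_pow]; ring

/-- One well-chosen value `n` of the Poisson variable suffices on the exponential scale, so the
other fibres are dropped. -/
lemma exists_le_measure_process_mem_Icc [IsProbabilityMeasure P] (hη : IsJumpChain P lam mu η)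
    (hν : IsPoissonProcess P α ν) (hind : IndepFun (fun ω t => ν t ω) (fun ω n => η n ω) P)
    (hlam : 0 < lam) (hmu : 0 < mu) :
    ∃ M : ℕ, ∀ (T : ℝ≥0) (n m : ℕ), m ≤ n →
      ENNReal.ofReal (Real.exp (-(α * T)) * (α * T) ^ n / n.factorial *
        ((lam / (lam + mu)) ^ m / 2)) ≤
      P {ω | m ≤ process η ν T ω ∧ process η ν T ω ≤ m + M} := by
  obtain ⟨M, hM⟩ := hη.exists_le_measure_mem_Icc hlam hmu
  refine ⟨M, fun T n m hmn => ?_⟩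
  rw [ENNReal.ofReal_mul (by positivity), ← hν.measure_eq]
  calc P {ω | ν T ω = n} * ENNReal.ofReal ((lam / (lam + mu)) ^ m / 2)
      ≤ P {ω | ν T ω = n} * P {ω | η n ω ∈ Set.Icc m (m + M)} := by
        gcongr; exact hM n m hmn
    _ = P ({ω | process η ν T ω ∈ Set.Icc m (m + M)} ∩ ν T ⁻¹' {n}) :=
        (measure_inter_process_mem hind T n _).symm
    _ ≤ _ := measure_mono Set.inter_subset_left

end Mixture

/-! ### Nonnegativity and compact level sets of the rate function. -/

section RateFunction

/-- The Poisson rate function `y log (y / a) - y + a` is nonnegative. -/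
lemma mul_log_div_sub_add_nonneg {a y : ℝ} (ha : 0 < a) (hy : 0 < y) :
    0 ≤ y * Real.log (y / a) - y + a := by
  have h := Real.one_sub_inv_le_log_of_pos (div_pos hy ha)
  have h2 : y * (1 - (y / a)⁻¹) = y - a := by field_simp
  nlinarith [mul_le_mul_of_nonneg_left h hy.le]

/-- A formula for `rateJ` on `[0, ∞)` without case distinction. -/
noncomputable def finiteRate (lam mu α k x : ℝ) : ℝ :=
  x * Real.log ((lam + mu) / lam) +
    (max (k * x) α * Real.log (max (k * x) α / α) - max (k * x) α + α) / k

variable {lam mu α k : ℝ}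

lemma rateJ_of_nonneg (hlam : 0 < lam) (hmu : 0 < mu) (hα : 0 < α) (hk : 0 < k) {x : ℝ}
    (hx : 0 ≤ x) : rateJ lam mu α k x = (finiteRate lam mu α k x : ℝ) := by
  unfold rateJ finiteRate
  rw [if_neg (not_lt.2 hx)]
  split_ifs with h
  · rw [lt_div_iff₀ hk, mul_comm] at h
    rw [max_eq_right h.le, div_self hα.ne']
    simp
  · rw [not_lt, div_le_iff₀ hk, mul_comm] at h
    have hkx : 0 < k * x := hα.trans_le h
    have hx0 : x ≠ 0 := by rintro rfl; simp at hkx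
    rw [max_eq_left h, show k * x * (lam + mu) / (α * lam) = (lam + mu) / lam * (k * x / α) by
      field_simp, Real.log_mul (by positivity) (by positivity)]
    congr 1
    field_simp
    ring

lemma continuous_finiteRate (hα : 0 < α) : Continuous (finiteRate lam mu α k) := by
  unfold finiteRate
  have h : Continuous fun x : ℝ => Real.log (max (k * x) α / α) :=
    Continuous.log (by fun_prop) fun x => by
      have : 0 < max (k * x) α := lt_max_of_lt_right hα
      positivity
  fun_prop

/-- Dropping the Poisson cost leaves a linear minorant of positive slope, which confines the level
sets to bounded intervals. -/
lemma mul_log_le_finiteRate (hα : 0 < α) (hk : 0 < k) (x : ℝ) :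
    x * Real.log ((lam + mu) / lam) ≤ finiteRate lam mu α k x := by
  unfold finiteRate
  have := mul_log_div_sub_add_nonneg hα (lt_max_of_lt_right hα : 0 < max (k * x) α)
  exact le_add_of_nonneg_right (by positivity)

lemma log_add_div_pos (hlam : 0 < lam) (hmu : 0 < mu) : 0 < Real.log ((lam + mu) / lam) :=
  Real.log_pos ((one_lt_div hlam).2 (by linarith))

lemma rateJ_nonneg (hlam : 0 < lam) (hmu : 0 < mu) (hα : 0 < α) (hk : 0 < k) (x : ℝ) :
    0 ≤ rateJ lam mu α k x := by
  rcases lt_or_ge x 0 with hx | hx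
  · rw [rateJ, if_pos hx]; exact le_top
  · rw [rateJ_of_nonneg hlam hmu hα hk hx]
    have := log_add_div_pos hlam hmu
    exact_mod_cast (show 0 ≤ x * Real.log ((lam + mu) / lam) by positivity).trans
      (mul_log_le_finiteRate hα hk x)

lemma isCompact_rateJ_le (hlam : 0 < lam) (hmu : 0 < mu) (hα : 0 < α) (hk : 0 < k) (c : ℝ) :
    IsCompact {x : ℝ | rateJ lam mu α k x ≤ (c : EReal)} := by
  have heq : {x : ℝ | rateJ lam mu α k x ≤ (c : EReal)} =
      Set.Ici 0 ∩ {x | finiteRate lam mu α k x ≤ c} := by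
    ext x
    simp only [Set.mem_inter_iff, Set.mem_Ici, Set.mem_ofPred_eq]
    rcases lt_or_ge x 0 with hx | hx
    · simp [rateJ, hx]
    · rw [rateJ_of_nonneg hlam hmu hα hk hx, EReal.coe_le_coe_iff]
      simp [hx]
  rw [heq]
  refine (isCompact_Icc (a := 0) (b := c / Real.log ((lam + mu) / lam))).of_isClosed_subset
    (isClosed_Ici.inter (isClosed_le (continuous_finiteRate hα) continuous_const)) ?_
  rintro x ⟨hx0, hx⟩
  refine ⟨hx0, ?_⟩
  rw [le_div_iff₀ (log_add_div_pos hlam hmu)]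
  exact (mul_log_le_finiteRate hα hk x).trans hx

end RateFunction

/-! ### Stirling-type asymptotics of Poisson weights. -/

section Asymptotics

/-- A one-sided Stirling bound is enough, since Poisson weights are only bounded below through it.
The induction step rests on `(n + 1) log ((n + 1) / n) ≥ 1`. -/
lemma log_factorial_le {n : ℕ} (hn : 1 ≤ n) :
    Real.log n.factorial ≤ n * Real.log n - n + Real.log n + 1 := by
  induction n, hn using Nat.le_induction with
  | base => simp
  | succ n hn ih =>
    have hn0 : (0 : ℝ) < n := by exact_mod_cast hn
    rw [Nat.factorial_succ]
    push_cast
    rw [Real.log_mul (by positivity) (by positivity)]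
    have h := Real.one_sub_inv_le_log_of_pos (show (0 : ℝ) < (n + 1) / n by positivity)
    rw [Real.log_div (by positivity) (by positivity)] at h
    have h2 : ((n : ℝ) + 1) * (1 - (((n : ℝ) + 1) / n)⁻¹) = 1 := by field_simp; ring
    have h3 := mul_le_mul_of_nonneg_left h (show (0 : ℝ) ≤ n + 1 by positivity)
    rw [h2] at h3
    linarith

variable {ι : Type*} {l : Filter ι}

lemma tendsto_natCeil_div {z s : ι → ℝ} {c : ℝ} (hs : Tendsto s l atTop)
    (hz : ∀ᶠ i in l, 0 ≤ z i) (h : Tendsto (fun i => z i / s i) l (𝓝 c)) :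
    Tendsto (fun i => (⌈z i⌉₊ : ℝ) / s i) l (𝓝 c) := by
  have h' : Tendsto (fun i => z i / s i + (s i)⁻¹) l (𝓝 c) := by
    simpa using h.add (tendsto_inv_atTop_zero.comp hs)
  refine tendsto_of_tendsto_of_tendsto_of_le_of_le' h h' ?_ ?_
  · filter_upwards [hs.eventually_gt_atTop 0] with i hi
    gcongr
    exact Nat.le_ceil _
  · filter_upwards [hs.eventually_gt_atTop 0, hz] with i hi hzi
    rw [← one_div, ← add_div]
    gcongr
    exact (Nat.ceil_lt_add_one hzi).le

/-- The logarithmic asymptotics of the Poisson weight `exp (-(a t)) (a t) ^ n / n !` with the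
factorial replaced by its Stirling bound. -/
lemma tendsto_log_poisson_weight {a y : ℝ} (ha : 0 < a) (hy : 0 < y) {t : ι → ℝ} {n : ι → ℕ}
    (ht : Tendsto t l atTop) (hn : Tendsto (fun i => (n i : ℝ) / t i) l (𝓝 y)) :
    Tendsto (fun i => (-(a * t i) + n i * Real.log (a * t i) -
        (n i * Real.log (n i) - n i + Real.log (n i) + 1)) / t i) l
      (𝓝 (-(y * Real.log (y / a) - y + a))) := by
  have hlog : Tendsto (fun i => Real.log (n i / t i)) l (𝓝 (Real.log y)) := hn.log hy.ne'
  have hloga : Tendsto (fun i => Real.log (n i / t i / a)) l (𝓝 (Real.log (y / a))) :=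
    (hn.div_const a).log (by positivity)
  have hinv : Tendsto (fun i => (t i)⁻¹) l (𝓝 0) := tendsto_inv_atTop_zero.comp ht
  have hlt : Tendsto (fun i => Real.log (t i) / t i) l (𝓝 0) :=
    Real.isLittleO_log_id_atTop.tendsto_div_nhds_zero.comp ht
  -- The expression is rewritten through `n / t`; the Stirling error `log n = log (n / t) + log t`
  -- vanishes after division by `t`.
  have key : Tendsto (fun i => -((n i : ℝ) / t i * Real.log (n i / t i / a) - n i / t i + a) -
      (Real.log (n i / t i) * (t i)⁻¹ + Real.log (t i) / t i) - (t i)⁻¹) l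
      (𝓝 (-(y * Real.log (y / a) - y + a) - (Real.log y * 0 + 0) - 0)) :=
    ((((hn.mul hloga).sub hn).add_const a).neg.sub ((hlog.mul hinv).add hlt)).sub hinv
  simp only [mul_zero, add_zero, sub_zero] at key
  refine key.congr' ?_
  filter_upwards [ht.eventually_gt_atTop 0, hn.eventually_const_lt hy] with i hti hni
  have hn0 : (0 : ℝ) < n i := by
    rcases (Nat.cast_nonneg (n i) : (0 : ℝ) ≤ n i).lt_or_eq with h | h
    · exact h
    · rw [← h, zero_div] at hni; exact absurd hni (lt_irrefl _)
  rw [Real.log_div (by positivity) ha.ne', Real.log_div hn0.ne' hti.ne',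
    Real.log_mul ha.ne' hti.ne']
  field_simp
  ring

end Asymptotics

/-! ### The upper and lower large deviation bounds. -/

section LargeDeviations

variable {Ω : Type*} [MeasurableSpace Ω] {P : Measure Ω} {lam mu k : ℝ} {α : ℝ≥0}
  {η : ℕ → Ω → ℕ} {ν : ℝ≥0 → Ω → ℕ} {φ : ℝ≥0 → ℝ}

lemma tendsto_atTop_of_tendsto_div (hk : 0 < k)
    (hφ : Tendsto (fun T : ℝ≥0 => φ T / (T : ℝ)) atTop (𝓝 k)) : Tendsto φ atTop atTop := by
  have hT : Tendsto (fun T : ℝ≥0 => (T : ℝ)) atTop atTop := NNReal.tendsto_coe_atTop.2 tendsto_id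
  refine (hφ.pos_mul_atTop hk hT).congr' ?_
  filter_upwards [eventually_gt_atTop 0] with T hT
  have : (T : ℝ) ≠ 0 := by exact_mod_cast hT.ne'
  field_simp

lemma tendsto_div_of_tendsto_div (hk : 0 < k)
    (hφ : Tendsto (fun T : ℝ≥0 => φ T / (T : ℝ)) atTop (𝓝 k)) :
    Tendsto (fun T : ℝ≥0 => (T : ℝ) / φ T) atTop (𝓝 k⁻¹) := by
  simpa using hφ.inv₀ hk.ne'

lemma limsup_log_measure_le_of_subset [IsProbabilityMeasure P] (hη : IsJumpChain P lam mu η)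
    (hν : IsPoissonProcess P α ν) (hind : IndepFun (fun ω t => ν t ω) (fun ω n => η n ω) P)
    (hlam : 0 < lam) (hmu : 0 < mu) (hk : 0 < k)
    (hφ : Tendsto (fun T : ℝ≥0 => φ T / (T : ℝ)) atTop (𝓝 k)) {A : ℝ≥0 → Set Ω} {x θ r : ℝ}
    (hθ : 0 ≤ θ) (hr : lam / (lam + mu) < r) (hr1 : r < 1)
    (hA : ∀ᶠ T in atTop, A T ⊆ {ω | x * φ T ≤ process η ν T ω}) :
    limsup (fun T : ℝ≥0 => ((1 / φ T : ℝ) : EReal) * ENNReal.log (P (A T))) atTop ≤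
      ((x * (Real.log r - θ) + α * k⁻¹ * (Real.exp θ - 1) : ℝ) : EReal) := by
  have hr0 : 0 < r := lt_trans (by positivity) hr
  obtain ⟨C, hC, hb⟩ := exists_measure_process_ge_le hη hν hind hlam hmu hr hr1
  have hφ' := tendsto_atTop_of_tendsto_div hk hφ
  have hlim : Tendsto (fun T : ℝ≥0 => ((Real.log C * (φ T)⁻¹ + x * (Real.log r - θ) +
      α * (T / φ T) * (Real.exp θ - 1) : ℝ) : EReal)) atTop
      (𝓝 ((x * (Real.log r - θ) + α * k⁻¹ * (Real.exp θ - 1) : ℝ) : EReal)) := by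
    rw [EReal.tendsto_coe]
    have h1 : Tendsto (fun T => (φ T)⁻¹) atTop (𝓝 0) := tendsto_inv_atTop_zero.comp hφ'
    simpa using ((h1.const_mul (Real.log C)).add_const (x * (Real.log r - θ))).add
      (((tendsto_div_of_tendsto_div hk hφ).const_mul (α : ℝ)).mul_const (Real.exp θ - 1))
  rw [← hlim.limsup_eq]
  refine limsup_le_limsup ?_
  filter_upwards [hA, hφ'.eventually_gt_atTop 0] with T hAT hφT
  set m := ⌈x * φ T⌉₊ with hm
  have hle : P (A T) ≤ ENNReal.ofReal
      (C * r ^ m * Real.exp (-θ * m + α * T * (Real.exp θ - 1))) := by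
    refine (measure_mono fun ω hω => ?_).trans (hb T θ m hθ)
    exact Nat.ceil_le.2 (hAT hω)
  have hlog : Real.log (C * r ^ m * Real.exp (-θ * m + α * T * (Real.exp θ - 1))) ≤
      Real.log C + x * φ T * (Real.log r - θ) + α * T * (Real.exp θ - 1) := by
    rw [Real.log_mul (by positivity) (by positivity), Real.log_mul hC.ne' (by positivity),
      Real.log_pow, Real.log_exp]
    -- The coefficient of `m` is nonpositive, so rounding `x * φ T` up to `m` only lowers the
    -- exponent.
    have h1 : Real.log r - θ ≤ 0 := by linarith [Real.log_nonpos hr0.le hr1.le]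
    have h2 := mul_le_mul_of_nonpos_right (Nat.le_ceil (x * φ T)) h1
    rw [← hm] at h2
    linarith
  calc ((1 / φ T : ℝ) : EReal) * ENNReal.log (P (A T))
      ≤ ((1 / φ T : ℝ) : EReal) *
        ((Real.log C + x * φ T * (Real.log r - θ) + α * T * (Real.exp θ - 1) : ℝ) : EReal) := by
        refine mul_le_mul_of_nonneg_left ?_ (by exact_mod_cast (by positivity))
        refine (ENNReal.log_le_log hle).trans ?_
        rw [ENNReal.log_ofReal_of_pos (by positivity)]
        exact_mod_cast hlog
    _ = _ := by
        rw [← EReal.coe_mul]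
        congr 1
        field_simp

lemma limsup_log_measure_scaled_le [IsProbabilityMeasure P] (hη : IsJumpChain P lam mu η)
    (hν : IsPoissonProcess P α ν) (hind : IndepFun (fun ω t => ν t ω) (fun ω n => η n ω) P)
    (hlam : 0 < lam) (hmu : 0 < mu) (hα : 0 < α) (hk : 0 < k)
    (hφ : Tendsto (fun T : ℝ≥0 => φ T / (T : ℝ)) atTop (𝓝 k)) (B : Set ℝ) :
    limsup (fun T : ℝ≥0 => ((1 / φ T : ℝ) : EReal) *
        ENNReal.log (P {ω | scaled (process η ν) φ T 1 ω ∈ B})) atTop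
      ≤ -(⨅ x ∈ closure B, rateJ lam mu α k x) := by
  have hφ' := tendsto_atTop_of_tendsto_div hk hφ
  have hα' : (0 : ℝ) < α := by exact_mod_cast hα
  rcases (closure B ∩ Set.Ici 0).eq_empty_or_nonempty with hD | hD
  · refine le_trans (limsup_le_of_le (a := ⊥) (h := ?_)) bot_le
    filter_upwards [hφ'.eventually_gt_atTop 0] with T hφT
    have : {ω | scaled (process η ν) φ T 1 ω ∈ B} = ∅ := by
      refine Set.eq_empty_of_forall_notMem fun ω hω => ?_
      refine (Set.eq_empty_iff_forall_notMem.1 hD) _ ⟨subset_closure hω, ?_⟩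
      simp only [scaled, Set.mem_Ici]
      positivity
    rw [this, measure_empty, ENNReal.log_zero, EReal.coe_mul_bot_of_pos (by positivity)]
  have hbdd : BddBelow (closure B ∩ Set.Ici 0) := ⟨0, fun x hx => hx.2⟩
  have hmem := (isClosed_closure.inter isClosed_Ici).csInf_mem hD hbdd
  -- The event lies in the half-line starting at the leftmost nonnegative point `x` of the closure.
  -- As `x` itself belongs to the closure, monotonicity of the rate is not needed.
  set x := sInf (closure B ∩ Set.Ici 0) with hx
  have hx0 : 0 ≤ x := hmem.2
  refine le_trans ?_ (EReal.neg_le_neg_iff.2 (iInf₂_le x hmem.1))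
  rw [rateJ_of_nonneg hlam hmu hα' hk hx0, ← EReal.coe_neg]
  set y := max (k * x) α with hy
  have hy0 : 0 < y := lt_max_of_lt_right hα'
  have hyα : α ≤ y := le_max_right _ _
  have hp : 0 < lam / (lam + mu) := by positivity
  have hp1 : lam / (lam + mu) < 1 := by rw [div_lt_one (by positivity)]; linarith
  -- The Chernoff exponent at the optimal tilt `θ = log (y / α)` and at the limit value `r = lam /
  -- (lam + mu)`. In `h2`, either `k * x = y` or the logarithm vanishes.
  have hval : -finiteRate lam mu α k x = x * (Real.log (lam / (lam + mu)) - Real.log (y / α)) +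
      α * k⁻¹ * (Real.exp (Real.log (y / α)) - 1) := by
    have h1 : Real.log ((lam + mu) / lam) = -Real.log (lam / (lam + mu)) := by
      rw [← Real.log_inv, inv_div]
    have h2 : x * Real.log (y / α) = y * Real.log (y / α) / k := by
      rcases le_total (k * x) α with h | h
      · rw [hy, max_eq_right h, div_self hα'.ne']; simp
      · rw [hy, max_eq_left h]; field_simp
    rw [finiteRate, h1, ← hy, Real.exp_log (by positivity), mul_sub, h2]
    field_simp
    ring
  have hlim : Tendsto (fun r : ℝ => ((x * (Real.log r - Real.log (y / α)) +
      α * k⁻¹ * (Real.exp (Real.log (y / α)) - 1) : ℝ) : EReal)) (𝓝[>] (lam / (lam + mu)))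
      (𝓝 ((-finiteRate lam mu α k x : ℝ) : EReal)) := by
    rw [EReal.tendsto_coe, hval]
    have h := (Real.continuousAt_log hp.ne').tendsto.mono_left
      (nhdsWithin_le_nhds (s := Set.Ioi (lam / (lam + mu))))
    exact ((h.sub_const _).const_mul x).add_const _
  refine ge_of_tendsto hlim ?_
  filter_upwards [Ioo_mem_nhdsGT hp1] with r hr
  refine limsup_log_measure_le_of_subset hη hν hind hlam hmu hk hφ
    (Real.log_nonneg ((one_le_div hα').2 hyα)) hr.1 hr.2 ?_
  filter_upwards [hφ'.eventually_gt_atTop 0] with T hφT ω hω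
  have h1 : scaled (process η ν) φ T 1 ω ∈ closure B ∩ Set.Ici 0 := by
    refine ⟨subset_closure hω, ?_⟩
    simp only [scaled, Set.mem_Ici]
    positivity
  have h2 := csInf_le hbdd h1
  rw [← hx, scaled, mul_one, le_div_iff₀ hφT] at h2
  exact h2

lemma neg_finiteRate_le_liminf [IsProbabilityMeasure P] (hη : IsJumpChain P lam mu η)
    (hν : IsPoissonProcess P α ν) (hind : IndepFun (fun ω t => ν t ω) (fun ω n => η n ω) P)
    (hlam : 0 < lam) (hmu : 0 < mu) (hα : 0 < α) (hk : 0 < k)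
    (hφ : Tendsto (fun T : ℝ≥0 => φ T / (T : ℝ)) atTop (𝓝 k)) {B : Set ℝ} {x : ℝ} (hx : 0 ≤ x)
    (hxB : x ∈ interior B) :
    ((-finiteRate lam mu α k x : ℝ) : EReal) ≤
      liminf (fun T : ℝ≥0 => ((1 / φ T : ℝ) : EReal) *
        ENNReal.log (P {ω | scaled (process η ν) φ T 1 ω ∈ B})) atTop := by
  have hφ' := tendsto_atTop_of_tendsto_div hk hφ
  have hα' : (0 : ℝ) < α := by exact_mod_cast hα
  have hT : Tendsto (fun T : ℝ≥0 => (T : ℝ)) atTop atTop := NNReal.tendsto_coe_atTop.2 tendsto_id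
  obtain ⟨ε, hε, hball⟩ := Metric.mem_nhds_iff.1 (mem_interior_iff_mem_nhds.1 hxB)
  obtain ⟨M, hM⟩ := exists_le_measure_process_mem_Icc hη hν hind hlam hmu
  set p := lam / (lam + mu) with hp
  have hp0 : 0 < p := by positivity
  set y := max (k * x) α with hy
  have hy0 : 0 < y := lt_max_of_lt_right hα'
  set m : ℝ≥0 → ℕ := fun T => ⌈x * φ T⌉₊ with hm
  -- The cheapest number of steps: the typical `α * T` when this already reaches the target height,
  -- otherwise the minimum needed.
  set n : ℝ≥0 → ℕ := fun T => ⌈max (x * φ T) (α * T)⌉₊ with hn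
  have hmlim : Tendsto (fun T => (m T : ℝ) / φ T) atTop (𝓝 x) := by
    refine tendsto_natCeil_div hφ' ?_ ?_
    · filter_upwards [hφ'.eventually_ge_atTop 0] with T h
      positivity
    · refine tendsto_const_nhds.congr' ?_
      filter_upwards [hφ'.eventually_gt_atTop 0] with T h
      field_simp
  have hnlim : Tendsto (fun T : ℝ≥0 => (n T : ℝ) / T) atTop (𝓝 y) := by
    refine tendsto_natCeil_div hT (.of_forall fun T => le_max_of_le_right (by positivity)) ?_
    have h1 : Tendsto (fun T : ℝ≥0 => max (φ T / T * x) (α : ℝ)) atTop (𝓝 y) :=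
      (hφ.mul_const x).max tendsto_const_nhds
    refine h1.congr' ?_
    filter_upwards [hT.eventually_gt_atTop 0] with T h
    rw [← max_div_div_right h.le]
    congr 1 <;> field_simp
  have hweight := tendsto_log_poisson_weight hα' hy0 hT hnlim
  have hlim : Tendsto (fun T : ℝ≥0 => (((-(α * T) + n T * Real.log (α * T) -
      (n T * Real.log (n T) - n T + Real.log (n T) + 1)) / T * (T / φ T) +
      ((m T : ℝ) / φ T * Real.log p - Real.log 2 * (φ T)⁻¹) : ℝ) : EReal)) atTop
      (𝓝 ((-finiteRate lam mu α k x : ℝ) : EReal)) := by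
    rw [EReal.tendsto_coe]
    have h1 : Tendsto (fun T => (φ T)⁻¹) atTop (𝓝 0) := tendsto_inv_atTop_zero.comp hφ'
    have h2 := (hweight.mul (tendsto_div_of_tendsto_div hk hφ)).add
      ((hmlim.mul_const (Real.log p)).sub (h1.const_mul (Real.log 2)))
    have h3 : -finiteRate lam mu α k x = -(y * Real.log (y / α) - y + α) * k⁻¹ +
        (x * Real.log p - Real.log 2 * 0) := by
      rw [finiteRate, ← hy, hp, ← inv_div (lam + mu) lam, Real.log_inv]
      ring
    rw [h3]
    exact h2
  rw [← hlim.liminf_eq]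
  refine liminf_le_liminf ?_
  -- The last condition absorbs the width `M` and the rounding error `1` into the radius `ε` after
  -- scaling.
  filter_upwards [hφ'.eventually_gt_atTop 0, hT.eventually_gt_atTop 0,
    hφ'.eventually_gt_atTop ((M + 1) / ε)] with T hφT hT0 hφM
  have hsub : {ω | m T ≤ process η ν T ω ∧ process η ν T ω ≤ m T + M} ⊆
      {ω | scaled (process η ν) φ T 1 ω ∈ B} := by
    rintro ω ⟨h1, h2⟩
    refine hball ?_
    rw [scaled, mul_one, Metric.mem_ball, Real.dist_eq, abs_lt]
    have h1' : x * φ T ≤ process η ν T ω := Nat.ceil_le.1 h1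
    have h2' : (process η ν T ω : ℝ) ≤ m T + M := by exact_mod_cast h2
    have h3 : (m T : ℝ) < x * φ T + 1 := Nat.ceil_lt_add_one (by positivity)
    rw [div_lt_iff₀ hε] at hφM
    constructor
    · have := (le_div_iff₀ hφT).2 h1'
      linarith
    · rw [sub_lt_iff_lt_add, div_lt_iff₀ hφT]
      linarith
  have hmn : m T ≤ n T := Nat.ceil_mono (le_max_left _ _)
  have hn1 : 1 ≤ n T := Nat.one_le_iff_ne_zero.2
    (Nat.ceil_pos.2 (lt_max_of_lt_right (by positivity))).ne'
  have hle := (hM T (n T) (m T) hmn).trans (measure_mono hsub)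
  have hlog : -(α * T) + n T * Real.log (α * T) -
      (n T * Real.log (n T) - n T + Real.log (n T) + 1) + (m T * Real.log p - Real.log 2) ≤
      Real.log (Real.exp (-(α * T)) * (α * T) ^ n T / (n T).factorial * (p ^ m T / 2)) := by
    have hf : (0 : ℝ) < (n T).factorial := by exact_mod_cast (n T).factorial_pos
    have ha : (0 : ℝ) < α * T := by positivity
    generalize (α : ℝ) * (T : ℝ) = a at ha ⊢
    rw [Real.log_mul (by positivity) (by positivity), Real.log_div (by positivity) hf.ne',
      Real.log_mul (by positivity) (by positivity), Real.log_exp, Real.log_pow,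
      Real.log_div (pow_pos hp0 (m T)).ne' two_ne_zero, Real.log_pow]
    linarith [log_factorial_le hn1]
  calc _ = ((1 / φ T : ℝ) : EReal) * ((-(α * T) + n T * Real.log (α * T) -
      (n T * Real.log (n T) - n T + Real.log (n T) + 1) +
        (m T * Real.log p - Real.log 2) : ℝ) : EReal) := by
        rw [← EReal.coe_mul]
        congr 1
        field_simp
    _ ≤ _ := by
        refine mul_le_mul_of_nonneg_left ?_ (by exact_mod_cast (by positivity))
        refine le_trans ?_ (ENNReal.log_le_log hle)
        rw [ENNReal.log_ofReal_of_pos (by positivity)]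
        exact_mod_cast hlog

end LargeDeviations

end UniformCatastrophes

theorem mainTheorem1 {Ω : Type*} [MeasurableSpace Ω] (P : Measure Ω) [IsProbabilityMeasure P]
    (lam mu : ℝ) (hlam : 0 < lam) (hmu : 0 < mu) (α : ℝ≥0) (hα : 0 < α)
    (ξ : ℝ≥0 → Ω → ℕ) (hξ : UniformCatastrophes.IsPoissonUniformCatastrophes P lam mu α ξ)
    (φ : ℝ≥0 → ℝ) (k : ℝ) (hk : 0 < k)
    (hφ : Tendsto (fun T : ℝ≥0 => φ T / (T : ℝ)) atTop (𝓝 k)) :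
    UniformCatastrophes.SatisfiesLDP P (fun T => UniformCatastrophes.scaled ξ φ T 1) φ
      (UniformCatastrophes.rateJ lam mu α k) := by
  obtain ⟨η, ν, hη, hν, hind, rfl⟩ := hξ
  have hα' : (0 : ℝ) < α := by exact_mod_cast hα
  refine ⟨UniformCatastrophes.tendsto_atTop_of_tendsto_div hk hφ,
    UniformCatastrophes.rateJ_nonneg hlam hmu hα' hk,
    fun c _ => UniformCatastrophes.isCompact_rateJ_le hlam hmu hα' hk c,
    fun B _ => UniformCatastrophes.limsup_log_measure_scaled_le hη hν hind hlam hmu hα hk hφ B,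
    fun B _ => ?_⟩
  -- The bound is proved at each point of the interior separately; at negative points the rate is
  -- infinite.
  rw [EReal.neg_le]
  refine le_iInf₂ fun x hx => ?_
  rcases lt_or_ge x 0 with hx0 | hx0
  · rw [UniformCatastrophes.rateJ, if_pos hx0]; exact le_top
  · rw [EReal.neg_le, UniformCatastrophes.rateJ_of_nonneg hlam hmu hα' hk hx0, ← EReal.coe_neg]
    exact UniformCatastrophes.neg_finiteRate_le_liminf hη hν hind hlam hmu hα hk hφ hx0 hx
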